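/- Let $m\ge 3$ be an integer and let $D\subset\{0,1,\dots,m-1\}$ with $1<\#D<m$. Let \[ K_{m,D}=\Bigl\{\sum_{j=1}^\infty \frac{a_j}{m^j} : a_j\in D \text{ for all } j\ge 1\Bigr\} \] be the associated missing-digit set, and put $a_n=\prod_{k=1}^n (m^k-1)$ for $n\ge 1$. Then the intersection \[ \Bigl\{\frac{1}{a_n} : n\ge 1\Bigr\}\cap K_{m,D} \] is finite. -/

import Mathlib

/-- The missing-digit set `K_{m,D}`: all sums `∑_{j ≥ 1} a_j / m ^ j` with every digit `a_j` in `D`.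
The digit `a_j` is stored as `a (j - 1)`, so that the digit sequence is indexed by all of `ℕ`. -/
def missingDigitSet (m : ℕ) (D : Finset ℕ) : Set ℝ :=
  {x | ∃ a : ℕ → ℕ, (∀ j, a j ∈ D) ∧ HasSum (fun j : ℕ => (a j : ℝ) / (m : ℝ) ^ (j + 1)) x}

/-! Long division makes the digits of `1 / a`, `a = a_n`, the integer parts of `m * (m ^ s % a) /
a`, so it suffices that the powers of `m` modulo `a` reach the part of `[0, a)` belonging to a
missing digit `d`. Fix a prime `p ∣ m - 1` and write `a = p ^ v * b` with `p ∤ b`. A suitable power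
`M` of `m` is `1` modulo `g = p ^ c * b`, and by lifting the exponent its order modulo `a` is `N = p
^ (v - c) = a / g`. Its powers therefore fill the whole class of `1` modulo `g`. Since `v - c` grows
with `n`, the gap `g` is eventually small against `a / m`, and every part is hit. -/

/-- Lifting the exponent at a prime `p ∣ m - 1`, stated for `m ^ 2` so that `p = 2` needs no
separate treatment. -/
theorem emultiplicity_sq_pow_sub_one {p m : ℕ} (hp : p.Prime) (hpm : (p : ℤ) ∣ (m : ℤ) - 1)
    (k : ℕ) :
    emultiplicity (p : ℤ) (((m : ℤ) ^ 2) ^ k - 1) =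
      emultiplicity (p : ℤ) ((m : ℤ) ^ 2 - 1) + emultiplicity p k := by
  have hpm2 : (p : ℤ) ∣ (m : ℤ) ^ 2 - 1 :=
    hpm.trans ⟨(m : ℤ) + 1, by ring⟩
  have hnd : ¬ (p : ℤ) ∣ (m : ℤ) ^ 2 := by
    intro h
    have h1 : (p : ℤ) ∣ 1 := by
      have := dvd_sub h hpm2
      simpa using this
    have := Int.natCast_dvd_natCast.mp (by simpa using h1 : (p : ℤ) ∣ ((1 : ℕ) : ℤ))
    exact hp.one_lt.ne' (Nat.dvd_one.mp this)
  rcases hp.eq_two_or_odd' with rfl | hodd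
  · have h4 : (4 : ℤ) ∣ (m : ℤ) ^ 2 - 1 := by
      obtain ⟨t, ht⟩ := hpm
      refine ⟨t * (t + 1), ?_⟩
      have : (m : ℤ) = 2 * t + 1 := by push_cast at ht; linarith
      rw [this]; ring
    have := Int.two_pow_sub_pow' (x := (m : ℤ) ^ 2) (y := 1) k h4 (by simpa using hnd)
    simpa [← Int.natCast_emultiplicity] using this
  · have := Int.emultiplicity_pow_sub_pow hp hodd (x := (m : ℤ) ^ 2) (y := 1) hpm2 hnd k
    simpa using this

/-- If every prime factor of `b` divides `y - 1`, then `b ∣ y ^ b - 1`. -/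
theorem dvd_pow_self_sub_one {b : ℕ} {y : ℤ}
    (h : ∀ q : ℕ, q.Prime → q ∣ b → (q : ℤ) ∣ y - 1) : (b : ℤ) ∣ y ^ b - 1 := by
  rw [Int.natCast_dvd, Nat.dvd_iff_prime_pow_dvd_dvd]
  intro q k hq hqk
  rw [← Int.natCast_dvd]
  rcases Nat.eq_zero_or_pos k with rfl | hk
  · simp
  -- This gives `q ^ (k + 1)`, one power more than needed.
  have h1 := dvd_sub_pow_of_dvd_sub (h q hq ((dvd_pow_self q hk.ne').trans hqk)) k
  rw [one_pow] at h1
  obtain ⟨e, he⟩ := hqk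
  rw [he, pow_mul, Nat.cast_pow]
  refine (pow_dvd_pow _ k.le_succ).trans (h1.trans ?_)
  simpa using sub_dvd_pow_sub_pow (y ^ q ^ k) 1 e

/-- A geometric progression whose terms are all `≡ 1` modulo `g` and pairwise distinct modulo
`g * N` for exponents below `N` meets every block `[g * t, g * (t + 1))` of residues. -/
theorem exists_pow_mod_mem_block {M g N : ℕ} (hg : 0 < g) (hM : M ≡ 1 [MOD g])
    (hinj : ∀ i j, i < j → j < N → ¬ M ^ i ≡ M ^ j [MOD g * N]) {t : ℕ} (ht : t < N) :
    ∃ j, (M ^ j % (g * N)) / g = t := by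
  have hN : 0 < N := by omega
  have hmaps : Set.MapsTo (fun j => (M ^ j % (g * N)) / g) (Finset.range N) (Finset.range N) := by
    intro j _
    simp only [Finset.coe_range, Set.mem_Iio]
    exact Nat.div_lt_of_lt_mul (Nat.mod_lt _ (by positivity))
  have hres : ∀ j, M ^ j % (g * N) % g = 1 % g := by
    intro j
    rw [Nat.mod_mul_right_mod]
    simpa [Nat.ModEq] using hM.pow j
  have heq : ∀ i j, (M ^ i % (g * N)) / g = (M ^ j % (g * N)) / g →
      M ^ i ≡ M ^ j [MOD g * N] := by
    intro i j hij
    have h1 := Nat.div_add_mod (M ^ i % (g * N)) g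
    have h2 := Nat.div_add_mod (M ^ j % (g * N)) g
    rw [hres] at h1 h2
    rw [hij] at h1
    exact h1.symm.trans h2
  have hinj' : Set.InjOn (fun j => (M ^ j % (g * N)) / g) (Finset.range N) := by
    intro i hi j hj hij
    simp only [Finset.coe_range, Set.mem_Iio] at hi hj
    rcases lt_trichotomy i j with h | h | h
    · exact absurd (heq i j hij) (hinj i j h hj)
    · exact h
    · exact absurd (heq i j hij).symm (hinj j i h hi)
  obtain ⟨j, -, hj⟩ := Finset.surjOn_of_injOn_of_card_le _ hmaps hinj' le_rfl
    (Finset.mem_coe.mpr (Finset.mem_range.mpr ht))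
  exact ⟨j, hj⟩

/-- When `2 * m ≤ N`, some block of length `g` lies inside the `d`-th of the `m` equal parts
of `[0, g * N)`. -/
theorem exists_block_in_part {m g N d : ℕ} (hm : 0 < m) (hg : 0 < g)
    (hd : d < m) (hN : 2 * m ≤ N) :
    ∃ t < N, ∀ r, r / g = t →
      d * (g * N) ≤ m * r ∧ m * r < (d + 1) * (g * N) := by
  -- The ceiling of `d * N / m`: the first block starting inside the part.
  refine ⟨(d * N + m - 1) / m, ?_, ?_⟩
  all_goals
    set t := (d * N + m - 1) / m with ht
    have h1 := Nat.div_add_mod (d * N + m - 1) m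
    have h2 := Nat.mod_lt (d * N + m - 1) hm
    rw [← ht] at h1
    have hlo : d * N ≤ m * t := by omega
    have hhi : m * (t + 1) ≤ (d + 1) * N := by rw [mul_add, add_mul]; omega
  · have : (d + 1) * N ≤ m * N := Nat.mul_le_mul_right _ hd
    have := Nat.le_of_mul_le_mul_left (hhi.trans this) hm
    omega
  · intro r hr
    have h3 := Nat.div_add_mod r g
    have h4 := Nat.mod_lt r hg
    rw [hr] at h3
    constructor
    · calc d * (g * N) = g * (d * N) := by ring
        _ ≤ g * (m * t) := Nat.mul_le_mul_left _ hlo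
        _ = m * (g * t) := by ring
        _ ≤ m * r := Nat.mul_le_mul_left _ (by omega)
    · calc m * r < m * (g * (t + 1)) := Nat.mul_lt_mul_of_pos_left (by rw [mul_add]; omega) hm
        _ = g * (m * (t + 1)) := by ring
        _ ≤ g * ((d + 1) * N) := Nat.mul_le_mul_left _ hhi
        _ = (d + 1) * (g * N) := by ring

/-- `∏ (m ^ k - 1)` is divisible by `p ^ n` times the `p`-part of `n!`, for `p ∣ m - 1`. -/
theorem pow_dvd_prod_pow_sub_one {p m n : ℕ} (hm : 0 < m) (hpm : (p : ℤ) ∣ (m : ℤ) - 1) :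
    p ^ (n + n.factorial.factorization p) ∣ ∏ k ∈ Finset.Icc 1 n, (m ^ k - 1) := by
  induction n with
  | zero => simp
  | succ n ih =>
    rw [Finset.prod_Icc_succ_top (by omega), Nat.factorial_succ,
      Nat.factorization_mul (by omega) (Nat.factorial_ne_zero n), Finsupp.add_apply]
    have key : p ^ ((n + 1).factorization p + 1) ∣ m ^ (n + 1) - 1 := by
      have h1 := dvd_sub_pow_of_dvd_sub hpm ((n + 1).factorization p)
      have h2 : (m : ℤ) ^ p ^ (n + 1).factorization p - 1 ∣ (m : ℤ) ^ (n + 1) - 1 := by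
        obtain ⟨e, he⟩ := Nat.ordProj_dvd (n + 1) p
        conv_rhs => rw [he, pow_mul]
        simpa using sub_dvd_pow_sub_pow ((m : ℤ) ^ p ^ (n + 1).factorization p) 1 e
      rw [one_pow] at h1
      rw [← Int.natCast_dvd_natCast, Nat.cast_sub (Nat.one_le_pow _ _ hm)]
      push_cast
      exact h1.trans h2
    have := mul_dvd_mul ih key
    rw [← pow_add] at this
    exact (pow_dvd_pow p (by omega)).trans this

/-- For large `n`, the powers of `m` modulo `a = ∏ (m ^ k - 1)` meet each of the `m` equal parts
of `[0, a)`. -/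
theorem exists_pow_mod_prod_mem_part {m : ℕ} (hm : 3 ≤ m) :
    ∃ n₀, ∀ n, n₀ ≤ n → ∀ d < m, ∃ s,
      d * (∏ k ∈ Finset.Icc 1 n, (m ^ k - 1)) ≤ m * (m ^ s % ∏ k ∈ Finset.Icc 1 n, (m ^ k - 1)) ∧
      m * (m ^ s % ∏ k ∈ Finset.Icc 1 n, (m ^ k - 1)) <
        (d + 1) * ∏ k ∈ Finset.Icc 1 n, (m ^ k - 1) := by
  obtain ⟨p, hp, hpdvd⟩ := Nat.exists_prime_and_dvd (n := m - 1) (by omega)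
  have hpm : (p : ℤ) ∣ (m : ℤ) - 1 := by
    have := Int.natCast_dvd_natCast.mpr hpdvd
    rwa [Nat.cast_sub (by omega), Nat.cast_one] at this
  have hpi : Prime (p : ℤ) := Nat.prime_iff_prime_int.mp hp
  have hsq : (m : ℤ) ^ 2 - 1 ≠ 0 := by
    have : (3 : ℤ) ≤ m := by exact_mod_cast hm
    nlinarith
  have hfin : FiniteMultiplicity (p : ℤ) ((m : ℤ) ^ 2 - 1) :=
    FiniteMultiplicity.of_prime_left hpi hsq
  set C := multiplicity (p : ℤ) ((m : ℤ) ^ 2 - 1) with hC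
  have hlte : ∀ k, k ≠ 0 → ∀ e, (p : ℤ) ^ e ∣ ((m : ℤ) ^ 2) ^ k - 1 ↔
      e ≤ C + k.factorization p := by
    intro k hk e
    rw [pow_dvd_iff_le_emultiplicity, emultiplicity_sq_pow_sub_one hp hpm,
      hfin.emultiplicity_eq_multiplicity, ← hC,
      (Nat.finiteMultiplicity_iff.mpr ⟨hp.one_lt.ne', Nat.pos_of_ne_zero hk⟩
        ).emultiplicity_eq_multiplicity, Nat.multiplicity_eq_factorization hp hk]
    exact_mod_cast Iff.rfl
  refine ⟨C + 2 * m, fun n hn d hd => ?_⟩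
  set a := ∏ k ∈ Finset.Icc 1 n, (m ^ k - 1) with ha
  have hpos : ∀ k, 1 ≤ k → 0 < m ^ k - 1 := fun k hk => by
    exact Nat.sub_pos_of_lt (Nat.one_lt_pow (by omega) (by omega))
  have ha0 : a ≠ 0 := (Finset.prod_pos fun k hk => hpos k (Finset.mem_Icc.mp hk).1).ne'
  set v := a.factorization p with hv
  set b := ordCompl[p] a with hb
  have hvb : p ^ v * b = a := Nat.ordProj_mul_ordCompl_eq_self a p
  have hb0 : 0 < b := Nat.ordCompl_pos p ha0
  have hcop : Nat.Coprime p b := Nat.coprime_ordCompl hp ha0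
  have hvlow : n + n.factorial.factorization p ≤ v :=
    (hp.pow_dvd_iff_le_factorization ha0).mp (pow_dvd_prod_pow_sub_one (by omega) hpm)
  set c := C + n.factorial.factorization p with hc
  -- The `n!` terms cancel, leaving `v - c ≥ n - C` with `C` independent of `n`.
  have hcv : 2 * m ≤ v - c := by omega
  -- The factor `n!` makes `m ^ (2 * n!)` equal to `1` modulo every prime of `b`; the exponent `b`
  -- lifts this to modulus `b` without changing the `p`-part.
  set Q := n.factorial * b with hQ
  have hQ0 : Q ≠ 0 := mul_ne_zero (Nat.factorial_ne_zero n) hb0.ne'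
  have hQp : Q.factorization p = n.factorial.factorization p := by
    rw [hQ, Nat.factorization_mul (Nat.factorial_ne_zero n) hb0.ne', Finsupp.add_apply,
      Nat.factorization_eq_zero_of_not_dvd (hp.coprime_iff_not_dvd.mp hcop), add_zero]
  have hbdvd : (b : ℤ) ∣ ((m : ℤ) ^ 2) ^ Q - 1 := by
    rw [hQ, pow_mul]
    refine dvd_pow_self_sub_one fun q hq hqb => ?_
    obtain ⟨k, hk, hqk⟩ := (hq.prime.dvd_finsetProd_iff _).mp
      (hqb.trans (Nat.ordCompl_dvd a p))
    obtain ⟨hk1, hkn⟩ := Finset.mem_Icc.mp hk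
    have h1 : (q : ℤ) ∣ (m : ℤ) ^ k - 1 := by
      have := Int.natCast_dvd_natCast.mpr hqk
      rwa [Nat.cast_sub (Nat.one_le_pow _ _ (by omega)), Nat.cast_pow, Nat.cast_one] at this
    obtain ⟨e, he⟩ := (Nat.dvd_factorial hk1 hkn).mul_left 2
    rw [← pow_mul, he, pow_mul]
    exact h1.trans (by simpa using sub_dvd_pow_sub_pow ((m : ℤ) ^ k) 1 e)
  have hpdvd' : (p : ℤ) ^ c ∣ ((m : ℤ) ^ 2) ^ Q - 1 := (hlte Q hQ0 c).mpr (by rw [hQp])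
  set g := p ^ c * b with hg
  set N := p ^ (v - c) with hN
  have hgN : g * N = a := by
    rw [← hvb, hg, hN, mul_right_comm, ← pow_add, Nat.add_sub_of_le (by omega)]
  have hg0 : 0 < g := Nat.mul_pos (pow_pos hp.pos _) hb0
  have hN2 : 2 * m ≤ N :=
    hcv.trans (Nat.lt_pow_self hp.one_lt).le
  have hM : (m ^ 2) ^ Q ≡ 1 [MOD g] := by
    refine (Nat.modEq_iff_dvd.mpr ?_).symm
    push_cast [hg]
    exact (IsCoprime.pow_left (Nat.isCoprime_iff_coprime.mpr hcop)).mul_dvd hpdvd' hbdvd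
  have hinj : ∀ i j, i < j → j < N →
      ¬ ((m ^ 2) ^ Q) ^ i ≡ ((m ^ 2) ^ Q) ^ j [MOD g * N] := by
    intro i j hij hjN hmod
    have h1 : (p : ℤ) ^ v ∣ (((m : ℤ) ^ 2) ^ Q) ^ j - (((m : ℤ) ^ 2) ^ Q) ^ i := by
      have h2 := Nat.modEq_iff_dvd.mp hmod
      rw [hgN, ← hvb] at h2
      push_cast at h2
      exact (dvd_mul_right _ _).trans h2
    have h3 : (((m : ℤ) ^ 2) ^ Q) ^ j - (((m : ℤ) ^ 2) ^ Q) ^ i =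
        (((m : ℤ) ^ 2) ^ Q) ^ i * (((m : ℤ) ^ 2) ^ (Q * (j - i)) - 1) := by
      rw [mul_sub, mul_one, pow_mul _ Q, ← pow_add, Nat.add_sub_of_le hij.le]
    have hcopm : IsCoprime ((p : ℤ) ^ v) ((((m : ℤ) ^ 2) ^ Q) ^ i) := by
      refine IsCoprime.pow (IsCoprime.pow_right (IsCoprime.pow_right ?_))
      obtain ⟨t, ht⟩ := hpm
      exact ⟨-t, 1, by linarith⟩
    rw [h3] at h1
    have hne : j - i ≠ 0 := by omega
    have h4 := (hlte _ (mul_ne_zero hQ0 hne) v).mp (hcopm.dvd_of_dvd_mul_left h1)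
    rw [Nat.factorization_mul hQ0 hne, Finsupp.add_apply, hQp] at h4
    have h5 : p ^ (v - c) ∣ j - i := (hp.pow_dvd_iff_le_factorization hne).mpr (by omega)
    have := Nat.le_of_dvd (by omega) h5
    omega
  obtain ⟨t, htN, ht⟩ := exists_block_in_part (g := g) (N := N) (by omega) hg0 hd hN2
  obtain ⟨j, hj⟩ := exists_pow_mod_mem_block hg0 hM hinj htN
  refine ⟨2 * (Q * j), ?_⟩
  rw [← pow_mul, ← pow_mul] at hj
  rw [← hgN]
  exact ht _ hj

/-- Members of a missing-digit set with digits below `m` lie in `[0, 1]`. -/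
theorem missingDigitSet_subset_Icc {m : ℕ} (hm : 2 ≤ m) {D : Finset ℕ}
    (hD : D ⊆ Finset.range m) : missingDigitSet m D ⊆ Set.Icc 0 1 := by
  rintro x ⟨a, ha, hx⟩
  have hm' : (2 : ℝ) ≤ m := by exact_mod_cast hm
  refine ⟨hx.nonneg fun j => by positivity, ?_⟩
  have hgeo : HasSum (fun j : ℕ => ((m : ℝ) - 1) / (m : ℝ) ^ (j + 1)) 1 := by
    have h := (hasSum_geometric_of_lt_one (r := (m : ℝ)⁻¹) (by positivity)
      (inv_lt_one_of_one_lt₀ (by linarith))).mul_left (((m : ℝ) - 1) / m)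
    have hm1 : (m : ℝ) - 1 ≠ 0 := by linarith
    have hval : ((m : ℝ) - 1) / m * (1 - (m : ℝ)⁻¹)⁻¹ = 1 := by
      field_simp
    rw [hval] at h
    refine h.congr_fun fun j => ?_
    rw [pow_succ, inv_pow]
    field_simp
  refine hasSum_le (fun j => ?_) hx hgeo
  have h1 : a j + 1 ≤ m := Finset.mem_range.mp (hD (ha j))
  have h2 : (a j : ℝ) + 1 ≤ m := by exact_mod_cast h1
  gcongr
  linarith

/-- Dropping the first digit. -/
theorem exists_digit_shift_mem {m : ℕ} (hm : 2 ≤ m) {D : Finset ℕ} {x : ℝ}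
    (hx : x ∈ missingDigitSet m D) : ∃ e ∈ D, (m : ℝ) * x - e ∈ missingDigitSet m D := by
  obtain ⟨a, ha, hx⟩ := hx
  refine ⟨a 0, ha 0, fun j => a (j + 1), fun j => ha _, ?_⟩
  have hm0 : (m : ℝ) ≠ 0 := by positivity
  have h := (hasSum_nat_add_iff' 1).mpr hx
  have hval : (m : ℝ) * (x - ∑ i ∈ Finset.range 1, (a i : ℝ) / (m : ℝ) ^ (i + 1)) =
      m * x - a 0 := by
    rw [Finset.sum_range_one, zero_add, pow_one]
    field_simp
  have h' := h.mul_left (m : ℝ)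
  rw [hval] at h'
  refine h'.congr_fun fun j => ?_
  rw [pow_succ (m : ℝ) (j + 1)]
  field_simp

/-- If `r / a` is in the missing-digit set and `m * r / a` is not an integer, then the first digit
of `r / a` is the integer part of `m * r / a`, and the fractional part is again in the set. -/
theorem digit_mem_and_mod_div_mem {m a r : ℕ} (hm : 2 ≤ m) (ha : 0 < a) {D : Finset ℕ}
    (hD : D ⊆ Finset.range m) (hr : ¬ a ∣ m * r) (hx : (r : ℝ) / a ∈ missingDigitSet m D) :
    m * r / a ∈ D ∧ ((m * r % a : ℕ) : ℝ) / a ∈ missingDigitSet m D := by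
  obtain ⟨e, he, hmem⟩ := exists_digit_shift_mem hm hx
  have ha' : (0 : ℝ) < a := by exact_mod_cast ha
  obtain ⟨h0, h1⟩ := missingDigitSet_subset_Icc hm hD hmem
  have heq : (m : ℝ) * (r / a) - e = (m * r - a * e) / a := by field_simp
  rw [heq] at h0 h1 hmem
  rw [div_le_one ha'] at h1
  have h0' : a * e ≤ m * r := by
    have : (0 : ℝ) ≤ m * r - a * e := by
      by_contra! hneg
      exact absurd h0 (not_le.mpr (div_neg_of_neg_of_pos hneg ha'))
    exact_mod_cast sub_nonneg.mp this
  have h1' : m * r ≤ a * e + a := by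
    have : (m : ℝ) * r ≤ a * e + a := by linarith
    exact_mod_cast this
  -- The tail could a priori equal `1`; `hr` excludes this, so `e` is the integer part.
  have hlt : m * r < a * (e + 1) :=
    lt_of_le_of_ne (by rwa [mul_add, mul_one]) fun h => hr ⟨_, h⟩
  have hdiv : m * r / a = e :=
    Nat.div_eq_of_lt_le (by rwa [mul_comm e]) (by rwa [mul_comm (e + 1)])
  refine ⟨hdiv ▸ he, ?_⟩
  have hmod := Nat.div_add_mod (m * r) a
  rw [hdiv] at hmod
  have hcast : ((m * r % a : ℕ) : ℝ) = m * r - a * e := by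
    rw [eq_sub_iff_add_eq']
    exact_mod_cast hmod
  rwa [hcast]

/-- If `1 / a` is in the missing-digit set with `a ≥ 2` coprime to `m`, then the digits of `1 / a`,
computed by long division, all belong to `D`. -/
theorem pow_mod_digit_mem {m a : ℕ} (hm : 2 ≤ m) (ha : 2 ≤ a) (hcop : Nat.Coprime a m)
    {D : Finset ℕ} (hD : D ⊆ Finset.range m) (hx : (1 : ℝ) / a ∈ missingDigitSet m D) (s : ℕ) :
    m * (m ^ s % a) / a ∈ D := by
  have hnd : ∀ s, ¬ a ∣ m * (m ^ s % a) := by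
    intro s h
    have h1 := (Nat.dvd_mod_iff dvd_rfl).mp (hcop.dvd_of_dvd_mul_left h)
    have := Nat.Coprime.eq_one_of_dvd (hcop.pow_right s) h1
    omega
  have hmem : ∀ s, ((m ^ s % a : ℕ) : ℝ) / a ∈ missingDigitSet m D := by
    intro s
    induction s with
    | zero => simpa [Nat.mod_eq_of_lt ha] using hx
    | succ s ih =>
      have := (digit_mem_and_mod_div_mem hm (by omega) hD (hnd s) ih).2
      rwa [Nat.mul_mod_mod, ← pow_succ'] at this
  exact (digit_mem_and_mod_div_mem hm (by omega) hD (hnd s) (hmem s)).1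

theorem mainTheorem4 (m : ℕ) (hm : 3 ≤ m) (D : Finset ℕ) (hD : D ⊆ Finset.range m)
    (hD_lower : 1 < D.card) (hD_upper : D.card < m) :
    ({x : ℝ | ∃ n : ℕ, 1 ≤ n ∧ x = 1 / ∏ k ∈ Finset.Icc 1 n, ((m : ℝ) ^ k - 1)} ∩
      missingDigitSet m D).Finite := by
  obtain ⟨n₀, hn₀⟩ := exists_pow_mod_prod_mem_part hm
  obtain ⟨d, hdm, hdD⟩ : ∃ d < m, d ∉ D := by
    obtain ⟨d, hd, hdD⟩ := Finset.exists_mem_notMem_of_card_lt_card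
      (s := D) (t := Finset.range m) (by rwa [Finset.card_range])
    exact ⟨d, Finset.mem_range.mp hd, hdD⟩
  refine ((Set.finite_Iio n₀).image
    fun n : ℕ => 1 / ∏ k ∈ Finset.Icc 1 n, ((m : ℝ) ^ k - 1)).subset ?_
  rintro x ⟨⟨n, hn, rfl⟩, hx⟩
  refine ⟨n, ?_, rfl⟩
  rw [Set.mem_Iio]
  by_contra! hle
  have hcast : ∏ k ∈ Finset.Icc 1 n, ((m : ℝ) ^ k - 1) =
      ((∏ k ∈ Finset.Icc 1 n, (m ^ k - 1) : ℕ) : ℝ) := by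
    rw [Nat.cast_prod]
    refine Finset.prod_congr rfl fun k _ => ?_
    rw [Nat.cast_sub (Nat.one_le_pow _ _ (by omega)), Nat.cast_pow, Nat.cast_one]
  rw [hcast] at hx
  have hcop : Nat.Coprime (∏ k ∈ Finset.Icc 1 n, (m ^ k - 1)) m := by
    refine Nat.Coprime.prod_left fun k hk => ?_
    obtain ⟨hk1, -⟩ := Finset.mem_Icc.mp hk
    have h := Nat.coprime_self_sub_left (m := 1) (n := m ^ k) (Nat.one_le_pow _ _ (by omega))
    exact Nat.Coprime.coprime_dvd_right (dvd_pow_self m (by omega)) (h.mpr (Nat.coprime_one_left _))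
  have ha0 : 0 < ∏ k ∈ Finset.Icc 1 n, (m ^ k - 1) := Finset.prod_pos fun k hk =>
    Nat.sub_pos_of_lt (Nat.one_lt_pow (by have := Finset.mem_Icc.mp hk; omega) (by omega))
  have ha2 : 2 ≤ ∏ k ∈ Finset.Icc 1 n, (m ^ k - 1) := by
    have h1 : m ^ 1 - 1 ∣ ∏ k ∈ Finset.Icc 1 n, (m ^ k - 1) :=
      Finset.dvd_prod_of_mem (fun k => m ^ k - 1) (Finset.mem_Icc.mpr ⟨le_rfl, hn⟩)
    have h2 := Nat.le_of_dvd ha0 h1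
    rw [pow_one] at h2
    omega
  obtain ⟨s, hlo, hhi⟩ := hn₀ n hle d hdm
  have hdigit := pow_mod_digit_mem (by omega) ha2 hcop hD hx s
  rw [Nat.div_eq_of_lt_le hlo hhi] at hdigit
  exact hdD hdigit
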